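/- Fix integers $r\ge 1$ and $n\ge 1$, and write $[m]=\{1,\dots,m\}$. For $k\ge 1$ let $\Pi_k^{(r)}$ be the poset, ordered by refinement, of all set partitions of $[rk]$ whose block sizes are divisible by $r$; let $M(k)$ be the number of its minimal elements, and $M(0)=1$. Define the numbers $r_k(\Pi_k^{(r)})$, $k\ge 1$, by the identity of formal power series $$\sum_{k\ge 1} r_k(\Pi_k^{(r)})\,\frac{z^k}{k!\,M(k)}=-\log\Bigl(\sum_{k\ge 0}(-1)^k\frac{z^k}{k!\,M(k)}\Bigr).$$ Let $\mathcal B$ be the set of all $r$-element sets of positive integers (blocks). Two blocks $b,b'\in\mathcal B$ are called crossing unless $\max b<\min b'$ or $\max b'<\min b$ (so every block crosses itself). A heap over $\mathcal B$ is a finite poset $P$ with a labelling $\varepsilon:P\to\mathcal B$ such that (i) $x,y\in P$ are comparable whenever $\varepsilon(x)$ and $\varepsilon(y)$ are crossing, and (ii) $\varepsilon(x)$ and $\varepsilon(y)$ are crossing whenever $y$ covers $x$ in $P$. Heaps are considered up to label-preserving poset isomorphism. A pyramid is a heap with exactly one maximal element. Then $r_n(\Pi_n^{(r)})$ equals the (finite)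 number of pyramids over $\mathcal B$ that have $n$ elements, whose labels are pairwise distinct and are exactly the blocks of some partition of $[rn]$ into blocks of size $r$, and whose unique maximal element is labelled by the block containing $rn$. -/

import Mathlib

noncomputable section

universe u

/-! ### The numbers `r_n(Q_n)` attached to a sequence of posets -/

/-- `M(n)`: the number of minimal elements of `Q n` for `n ≥ 1`, and `M(0) = 1`. -/
def numMinimal (Q : ℕ → Type u) [∀ n, PartialOrder (Q n)] (n : ℕ) : ℕ :=
  if n = 0 then 1 else Nat.card {x : Q n // IsMin x}

/-- The formal power series `∑_{n ≥ 0} (-1)^n z^n / (n! M(n))`. -/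
def signedSeries (Q : ℕ → Type u) [∀ n, PartialOrder (Q n)] : PowerSeries ℚ :=
  PowerSeries.mk fun n => (-1) ^ n / ((n.factorial : ℚ) * numMinimal Q n)

/-- The number `r_n(Q_n)`, read off from
`∑_{n ≥ 1} r_n(Q_n) z^n / (n! M(n)) = - log (∑_{n ≥ 0} (-1)^n z^n / (n! M(n)))`. -/
def rNumber (Q : ℕ → Type u) [∀ n, PartialOrder (Q n)] (n : ℕ) : ℚ :=
  (n.factorial : ℚ) * numMinimal Q n *
    PowerSeries.coeff n (-PowerSeries.logOf (signedSeries Q))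

/-- The numbers `rNumber Q n` satisfy their defining equation as soon as every `Q n` has
a positive finite number of minimal elements. -/
theorem rNumber_spec (Q : ℕ → Type u) [∀ n, PartialOrder (Q n)]
    (hM : ∀ n, numMinimal Q n ≠ 0) :
    (PowerSeries.mk fun n =>
        if n = 0 then 0 else rNumber Q n / ((n.factorial : ℚ) * numMinimal Q n)) =
      -PowerSeries.logOf (signedSeries Q) := by
  ext n
  rw [PowerSeries.coeff_mk]
  split_ifs with h
  · subst h
    have h1 : PowerSeries.constantCoeff (signedSeries Q) = 1 := by
      rw [← PowerSeries.coeff_zero_eq_constantCoeff_apply, signedSeries, PowerSeries.coeff_mk]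
      simp [numMinimal]
    rw [PowerSeries.coeff_zero_eq_constantCoeff_apply, map_neg,
      PowerSeries.constantCoeff_logOf h1, neg_zero]
  · have h2 : (n.factorial : ℚ) * numMinimal Q n ≠ 0 :=
      mul_ne_zero (by exact_mod_cast n.factorial_ne_zero) (by exact_mod_cast hM n)
    rw [rNumber, mul_div_cancel_left₀ _ h2]

/-! ### Set partitions of `[rn]` -/

/-- The set partitions of `[rn] = {1, …, rn}` whose block sizes are divisible by `r`, ordered by
refinement (the order of `Finpartition`: every block of the smaller partition is contained in a
block of the larger one). -/
abbrev DivPartition (r n : ℕ) : Type :=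
  {π : Finpartition (Finset.Icc 1 (r * n)) // ∀ b ∈ π.parts, r ∣ b.card}

/-- The set partitions of `[rn]` all of whose blocks have exactly `r` elements. -/
abbrev UniformPartition (r n : ℕ) : Type :=
  {π : Finpartition (Finset.Icc 1 (r * n)) // ∀ b ∈ π.parts, b.card = r}

/-! ### Heaps and pyramids -/

/-- A heap of pieces from `B` with respect to the relation `R` (meant to be symmetric and
reflexive): a finite poset whose elements are labelled by pieces, such that elements with related
labels are comparable, and labels along a covering relation are related. -/
structure Heap {B : Type u} (R : B → B → Prop) : Type (max u 1) where
  /-- the elements of the heap -/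
  carrier : Type
  [order : PartialOrder carrier]
  [finite : Finite carrier]
  /-- the labelling of the elements by pieces -/
  label : carrier → B
  comparable : ∀ x y : carrier, R (label x) (label y) → x ≤ y ∨ y ≤ x
  covBy_rel : ∀ x y : carrier, x ⋖ y → R (label x) (label y)

namespace Heap

variable {B : Type u} {R : B → B → Prop}

instance (H : Heap R) : PartialOrder H.carrier := H.order

instance (H : Heap R) : Finite H.carrier := H.finite

/-- Isomorphism of heaps: an isomorphism of posets that preserves labels. -/
def Iso (H K : Heap R) : Prop :=
  ∃ e : H.carrier ≃o K.carrier, ∀ x, K.label (e x) = H.label x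

instance isoSetoid (R : B → B → Prop) : Setoid (Heap R) where
  r := Iso
  iseqv :=
    { refl := fun H => ⟨OrderIso.refl _, fun _ => rfl⟩
      symm := by
        rintro H K ⟨e, he⟩
        refine ⟨e.symm, fun x => ?_⟩
        rw [← he, e.apply_symm_apply]
      trans := by
        rintro H K L ⟨e, he⟩ ⟨f, hf⟩
        refine ⟨e.trans f, fun x => ?_⟩
        rw [OrderIso.trans_apply, hf, he] }

/-- A pyramid is a heap with exactly one maximal element. -/
def IsPyramid (H : Heap R) : Prop :=
  ∃! m : H.carrier, IsMax m

end Heap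

/-- The set of heaps with pieces in `B` and relation `R`; as usual, isomorphic
heaps are identified. -/
abbrev HeapClass {B : Type u} (R : B → B → Prop) : Type (max u 1) :=
  Quotient (Heap.isoSetoid R)

/-! ### Blocks and crossings -/

/-- The pieces: `r`-element sets of positive integers. -/
abbrev Block (r : ℕ) : Type :=
  {s : Finset ℕ // s.card = r ∧ ∀ i ∈ s, 1 ≤ i}

/-- Two blocks are crossing unless the largest element of one of them is smaller than the smallest
element of the other one, that is, unless one of them lies entirely to the left of the other. -/
def Crossing {r : ℕ} (s t : Block r) : Prop :=
  ¬ ((∀ i ∈ s.1, ∀ j ∈ t.1, i < j) ∨ (∀ j ∈ t.1, ∀ i ∈ s.1, j < i))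

theorem crossing_refl {r : ℕ} (hr : 1 ≤ r) (s : Block r) : Crossing s s := by
  obtain ⟨i, hi⟩ : s.1.Nonempty := Finset.card_pos.1 (by rw [s.2.1]; exact hr)
  rintro (h | h) <;> exact lt_irrefl i (h i hi i hi)

theorem crossing_symm {r : ℕ} {s t : Block r} (h : Crossing s t) : Crossing t s :=
  fun h' => h h'.symm

/-- The elements of the heap `H` are exactly the blocks of the partition `π`: distinct elements have
distinct labels, and the labels are exactly the blocks of `π`. -/
def HasBlocks {r n : ℕ} (H : Heap (Crossing (r := r))) (π : UniformPartition r n) : Prop :=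
  Function.Injective H.label ∧
    ∀ b : Finset ℕ, b ∈ π.1.parts ↔ ∃ x : H.carrier, (H.label x).1 = b

/-- The set of all (isomorphism classes of) pyramids of `r`-blocks with `n` elements which are
exactly the blocks of a partition of `[rn]` into `r`-blocks, such that the unique maximal element
is the block containing `rn`. -/
def blockPyramids (r n : ℕ) : Set (HeapClass (Crossing (r := r))) :=
  {q | ∃ H : Heap (Crossing (r := r)), Quotient.mk _ H = q ∧ H.IsPyramid ∧
    Nat.card H.carrier = n ∧ (∃ π : UniformPartition r n, HasBlocks H π) ∧
    ∀ m : H.carrier, IsMax m → r * n ∈ (H.label m).1}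

end

/-!
The identity is an instance of Viennot's inversion for heaps. Fix a partition `V` of a finite set
`A` into `r`-blocks and a point `a ∈ A`. Summing `(-1) ^ #T` over the pairs of a set `T ⊆ V` of
pairwise noncrossing blocks and a heap on `V \ T` all of whose maximal pieces contain `a` gives
`0`: putting `T` below the heap yields a heap on `V`, and a given heap on `V` is obtained from
exactly those `T` that consist of minimal pieces and include all maximal pieces not containing `a`,
an interval of sets with more than one element.

Now sum over `V`. A set of `r * k` points has exactly one partition into pairwise noncrossing
`r`-blocks, so only the union of `T` matters, and the number `p m` of pyramids on `r * m` points
with `a` in the top block satisfies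
`∑ k < m, (-1) ^ k * (r * m - 1).choose (r * k) * p (m - k) = (-1) ^ (m + 1)`.
Since `k! M(k) = (r k)! / r! ^ k`, comparing coefficients in `F * (log F)' = F'` for the series `F`
inside the logarithm gives the same recursion for the numbers `rNumber`.
-/

open Finset

section HeapOrder

variable {α : Type*} {C : α → α → Prop} {V T : Finset α} {ρ σ : Finset (α × α)}

open scoped Classical in
/-- The elements of `V` that are minimal for the relation given by the set of pairs `ρ`. -/
noncomputable def minElements (V : Finset α) (ρ : Finset (α × α)) : Finset α :=
  {x ∈ V | ∀ y, (y, x) ∈ ρ → y = x}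

open scoped Classical in
/-- The elements of `V` that are maximal for the relation given by the set of pairs `ρ`. -/
noncomputable def maxElements (V : Finset α) (ρ : Finset (α × α)) : Finset α :=
  {x ∈ V | ∀ y, (x, y) ∈ ρ → y = x}

theorem mem_minElements {x : α} : x ∈ minElements V ρ ↔ x ∈ V ∧ ∀ y, (y, x) ∈ ρ → y = x := by
  simp [minElements]

theorem mem_maxElements {x : α} : x ∈ maxElements V ρ ↔ x ∈ V ∧ ∀ y, (x, y) ∈ ρ → y = x := by
  simp [maxElements]

theorem minElements_subset (V : Finset α) (ρ : Finset (α × α)) : minElements V ρ ⊆ V :=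
  fun _ hx => (mem_minElements.1 hx).1

/-- The set of pairs `ρ` is a partial order on `V` that makes `V`, labelled by its own elements,
a heap with respect to `C`. The condition on covering pairs is encoded by `step`: from each element
one can move along `C` towards any larger element. -/
structure IsHeapOrder (C : α → α → Prop) (V : Finset α) (ρ : Finset (α × α)) : Prop where
  mem : ∀ ⦃x y⦄, (x, y) ∈ ρ → x ∈ V ∧ y ∈ V
  refl : ∀ ⦃x⦄, x ∈ V → (x, x) ∈ ρ
  trans : ∀ ⦃x y z⦄, (x, y) ∈ ρ → (y, z) ∈ ρ → (x, z) ∈ ρ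
  antisymm : ∀ ⦃x y⦄, (x, y) ∈ ρ → (y, x) ∈ ρ → x = y
  comparable : ∀ ⦃x y⦄, x ∈ V → y ∈ V → C x y → (x, y) ∈ ρ ∨ (y, x) ∈ ρ
  step : ∀ ⦃x y⦄, (x, y) ∈ ρ → x ≠ y → ∃ z, C x z ∧ x ≠ z ∧ (x, z) ∈ ρ ∧ (z, y) ∈ ρ

open scoped Classical in
/-- The finite set of all heap orders on `V`. -/
noncomputable def heapOrders (C : α → α → Prop) (V : Finset α) : Finset (Finset (α × α)) :=
  {ρ ∈ (V ×ˢ V).powerset | IsHeapOrder C V ρ}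

theorem mem_heapOrders : ρ ∈ heapOrders C V ↔ IsHeapOrder C V ρ := by
  simp only [heapOrders, mem_filter, mem_powerset, and_iff_right_iff_imp]
  rintro h ⟨x, y⟩ hxy
  exact mem_product.2 (h.mem hxy)

namespace IsHeapOrder

/-- The elements of a heap order, a copy of `V` on which the order is an instance. -/
@[ext]
structure Elements (h : IsHeapOrder C V ρ) where
  val : α
  mem : val ∈ V

instance (h : IsHeapOrder C V ρ) : PartialOrder h.Elements where
  le x y := (x.val, y.val) ∈ ρ
  le_refl x := h.refl x.mem
  le_trans _ _ _ hxy hyz := h.trans hxy hyz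
  le_antisymm _ _ hxy hyx := Elements.ext (h.antisymm hxy hyx)

/-- The elements of a heap order on `V` are the elements of `V`. -/
def elementsEquiv (h : IsHeapOrder C V ρ) : h.Elements ≃ V where
  toFun x := ⟨x.val, x.mem⟩
  invFun x := ⟨x.1, x.2⟩

instance (h : IsHeapOrder C V ρ) : Finite h.Elements :=
  Finite.of_equiv _ h.elementsEquiv.symm

theorem isMin_iff (h : IsHeapOrder C V ρ) {x : h.Elements} :
    IsMin x ↔ x.val ∈ minElements V ρ := by
  rw [mem_minElements]
  constructor
  · intro hx
    refine ⟨x.mem, fun y hyx => ?_⟩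
    have hle : (⟨y, (h.mem hyx).1⟩ : h.Elements) ≤ x := hyx
    exact congrArg Elements.val (hx.eq_of_le hle)
  · exact fun hx y hyx => (Elements.ext (hx.2 y.val hyx)).ge

theorem isMax_iff (h : IsHeapOrder C V ρ) {x : h.Elements} :
    IsMax x ↔ x.val ∈ maxElements V ρ := by
  rw [mem_maxElements]
  constructor
  · intro hx
    refine ⟨x.mem, fun y hxy => ?_⟩
    have hle : x ≤ (⟨y, (h.mem hxy).2⟩ : h.Elements) := hxy
    exact congrArg Elements.val (hx.eq_of_le hle).symm
  · exact fun hx y hxy => (Elements.ext (hx.2 y.val hxy)).le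

theorem exists_minElements_le (h : IsHeapOrder C V ρ) {x : α} (hx : x ∈ V) :
    ∃ m ∈ minElements V ρ, (m, x) ∈ ρ := by
  obtain ⟨m, hmx, hm⟩ := Finite.exists_le_minimal (α := h.Elements) (p := fun _ => True)
    (a := ⟨x, hx⟩) trivial
  exact ⟨m.val, h.isMin_iff.1 (minimal_true.1 hm), hmx⟩

theorem exists_le_maxElements (h : IsHeapOrder C V ρ) {x : α} (hx : x ∈ V) :
    ∃ m ∈ maxElements V ρ, (x, m) ∈ ρ := by
  obtain ⟨m, hxm, hm⟩ := Finite.exists_le_maximal (α := h.Elements) (p := fun _ => True)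
    (a := ⟨x, hx⟩) trivial
  exact ⟨m.val, h.isMax_iff.1 (maximal_true.1 hm), hxm⟩

theorem isAntichain_minElements (h : IsHeapOrder C V ρ) :
    IsAntichain C (minElements V ρ : Set α) := by
  intro x hx y hy hne hxy
  rw [mem_coe, mem_minElements] at hx hy
  rcases h.comparable hx.1 hy.1 hxy with hle | hle
  · exact hne (hy.2 x hle)
  · exact hne (hx.2 y hle).symm

end IsHeapOrder

open scoped Classical in
/-- The restriction of the order `ρ` to the elements outside `T`, for a set `T` of minimal elements:
only the smaller element of a pair has to be tested. -/
noncomputable def removeBelow (T : Finset α) (ρ : Finset (α × α)) : Finset (α × α) :=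
  {p ∈ ρ | p.1 ∉ T}

open scoped Classical in
/-- The order obtained from `σ` by inserting the elements of an antichain `T` as far down as
possible: `x ∈ T` is placed below everything that lies above an element related to `x`. -/
noncomputable def addBelow (C : α → α → Prop) (T : Finset α) (σ : Finset (α × α)) :
    Finset (α × α) :=
  σ ∪ T.diag ∪ {p ∈ T ×ˢ σ.image Prod.snd | ∃ z, C p.1 z ∧ (z, p.2) ∈ σ}

theorem mem_removeBelow {x y : α} : (x, y) ∈ removeBelow T ρ ↔ (x, y) ∈ ρ ∧ x ∉ T := by
  simp only [removeBelow, mem_filter]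

theorem mem_addBelow {x y : α} :
    (x, y) ∈ addBelow C T σ ↔ (x, y) ∈ σ ∨ x ∈ T ∧ (x = y ∨ ∃ z, C x z ∧ (z, y) ∈ σ) := by
  simp only [addBelow, mem_union, mem_diag, mem_filter, mem_product, mem_image, Prod.exists,
    exists_eq_right]
  grind

theorem eq_of_mem_minElements (hT : T ⊆ minElements V ρ) {x y : α} (hxy : (x, y) ∈ ρ)
    (hy : y ∈ T) : x = y :=
  (mem_minElements.1 (hT hy)).2 x hxy

theorem addBelow_removeBelow (h : IsHeapOrder C V ρ) (hT : T ⊆ minElements V ρ) :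
    addBelow C T (removeBelow T ρ) = ρ := by
  ext ⟨x, y⟩
  simp only [mem_addBelow, mem_removeBelow]
  constructor
  · rintro (⟨hxy, -⟩ | ⟨hx, rfl | ⟨z, hxz, hzy, hz⟩⟩)
    · exact hxy
    · exact h.refl (minElements_subset V ρ (hT hx))
    · rcases h.comparable (minElements_subset V ρ (hT hx)) (h.mem hzy).1 hxz with hle | hle
      · exact h.trans hle hzy
      · exact absurd (eq_of_mem_minElements hT hle hx ▸ hx) hz
  · intro hxy
    by_cases hx : x ∈ T
    · refine Or.inr ⟨hx, or_iff_not_imp_left.2 fun hne => ?_⟩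
      obtain ⟨z, hxz, hne', hle, hzy⟩ := h.step hxy hne
      exact ⟨z, hxz, hzy, fun hz => hne' (eq_of_mem_minElements hT hle hz)⟩
    · exact Or.inl ⟨hxy, hx⟩

open scoped Classical in
/-- The heap orders on `V` all of whose maximal elements lie in `M`. For `v ∈ V` and `M = {v}` these
are the pyramids with top `v`. -/
noncomputable def heapOrdersWithMaxIn (C : α → α → Prop) (V : Finset α) (M : Set α) :
    Finset (Finset (α × α)) :=
  {ρ ∈ heapOrders C V | ∀ x ∈ maxElements V ρ, x ∈ M}

theorem mem_heapOrdersWithMaxIn {M : Set α} :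
    ρ ∈ heapOrdersWithMaxIn C V M ↔ IsHeapOrder C V ρ ∧ ∀ x ∈ maxElements V ρ, x ∈ M := by
  simp only [heapOrdersWithMaxIn, mem_filter, mem_heapOrders]

open scoped Classical in
/-- The subsets of `V` whose distinct elements are never related by `C`. -/
noncomputable def antichains (C : α → α → Prop) (V : Finset α) : Finset (Finset α) :=
  {T ∈ V.powerset | IsAntichain C ((T : Finset α) : Set α)}

theorem mem_antichains : T ∈ antichains C V ↔ T ⊆ V ∧ IsAntichain C (T : Set α) := by
  simp only [antichains, mem_filter, mem_powerset]

open scoped Classical in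
theorem IsHeapOrder.filter_maxElements_ne_minElements (h : IsHeapOrder C V ρ) {M : Set α} {x : α}
    (hx : x ∈ V) (hxM : x ∈ M) : {x ∈ maxElements V ρ | x ∉ M} ≠ minElements V ρ := by
  intro heq
  obtain ⟨m, hm, hmx⟩ := h.exists_minElements_le hx
  rw [← heq, mem_filter, mem_maxElements] at hm
  exact hm.2 (hm.1.2 x hmx ▸ hxM)

variable [DecidableEq α]

theorem isHeapOrder_removeBelow (h : IsHeapOrder C V ρ) (hT : T ⊆ minElements V ρ) :
    IsHeapOrder C (V \ T) (removeBelow T ρ) := by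
  have notMem_of_le {x y : α} (hxy : (x, y) ∈ ρ) (hx : x ∉ T) : y ∉ T :=
    fun hy => hx (eq_of_mem_minElements hT hxy hy ▸ hy)
  constructor <;> simp only [mem_removeBelow, mem_sdiff]
  · exact fun x y ⟨hxy, hx⟩ =>
      ⟨⟨(h.mem hxy).1, hx⟩, (h.mem hxy).2, notMem_of_le hxy hx⟩
  · exact fun x ⟨hxV, hx⟩ => ⟨h.refl hxV, hx⟩
  · exact fun x y z ⟨hxy, hx⟩ ⟨hyz, _⟩ => ⟨h.trans hxy hyz, hx⟩
  · exact fun x y ⟨hxy, _⟩ ⟨hyx, _⟩ => h.antisymm hxy hyx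
  · exact fun x y ⟨hxV, hx⟩ ⟨hyV, hy⟩ hC => (h.comparable hxV hyV hC).imp (⟨·, hx⟩) (⟨·, hy⟩)
  · rintro x y ⟨hxy, hx⟩ hne
    obtain ⟨z, hC, hxz, hle, hzy⟩ := h.step hxy hne
    exact ⟨z, hC, hxz, ⟨hle, hx⟩, hzy, notMem_of_le hle hx⟩

theorem isHeapOrder_addBelow [Std.Symm C] (hT : T ⊆ V) (hanti : IsAntichain C (T : Set α))
    (h : IsHeapOrder C (V \ T) σ) : IsHeapOrder C V (addBelow C T σ) := by
  have hmem := h.mem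
  have hrefl := h.refl
  simp only [mem_sdiff] at hmem hrefl
  constructor <;> simp only [mem_addBelow]
  · grind
  · grind
  · have := h.trans
    grind
  · have := h.antisymm
    grind
  · intro x y hx hy hxy
    have hcomp := h.comparable (x := x) (y := y)
    have hyx := symm_of C hxy
    have heq : x ∈ T → y ∈ T → x = y := fun hxT hyT => hanti.eq hxT hyT hxy
    simp only [mem_sdiff] at hcomp
    grind
  · rintro x y (hxy | ⟨hx, rfl | ⟨z, hxz, hzy⟩⟩) hne
    · obtain ⟨z, hz⟩ := h.step hxy hne
      exact ⟨z, by grind⟩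
    · exact absurd rfl hne
    · exact ⟨z, hxz, by grind⟩

theorem maxElements_removeBelow (T : Finset α) :
    maxElements (V \ T) (removeBelow T ρ) = maxElements V ρ \ T := by
  ext x
  simp only [mem_maxElements, mem_sdiff, mem_removeBelow]
  grind

theorem subset_minElements_addBelow (h : IsHeapOrder C (V \ T) σ) (hT : T ⊆ V) :
    T ⊆ minElements V (addBelow C T σ) := by
  have hmem := h.mem
  simp only [mem_sdiff] at hmem
  intro x hx
  simp only [mem_minElements, mem_addBelow]
  grind

theorem removeBelow_addBelow (h : IsHeapOrder C (V \ T) σ) :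
    removeBelow T (addBelow C T σ) = σ := by
  have hmem := h.mem
  simp only [mem_sdiff] at hmem
  ext ⟨x, y⟩
  simp only [mem_removeBelow, mem_addBelow]
  grind

open scoped Classical in
theorem card_heapOrdersWithMaxIn_sdiff [Std.Symm C] (hT : T ⊆ V)
    (hanti : IsAntichain C (T : Set α)) (M : Set α) :
    #(heapOrdersWithMaxIn C (V \ T) M) =
      #{ρ ∈ heapOrders C V | T ∈ Icc {x ∈ maxElements V ρ | x ∉ M} (minElements V ρ)} := by
  refine card_nbij' (addBelow C T) (removeBelow T) ?_ ?_ ?_ ?_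
  · intro σ hσ
    obtain ⟨hσ, hmax⟩ := mem_heapOrdersWithMaxIn.1 hσ
    rw [← removeBelow_addBelow hσ, maxElements_removeBelow] at hmax
    refine mem_filter.2 ⟨mem_heapOrders.2 (isHeapOrder_addBelow hT hanti hσ), mem_Icc.2
      ⟨fun x hx => ?_, subset_minElements_addBelow hσ hT⟩⟩
    obtain ⟨hx, hxM⟩ := mem_filter.1 hx
    exact by_contra fun hxT => hxM (hmax x (mem_sdiff.2 ⟨hx, hxT⟩))
  · intro ρ hρ
    simp only [coe_filter, Set.mem_ofPred_eq, mem_heapOrders, mem_Icc] at hρ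
    obtain ⟨hρ, hmax, hmin⟩ := hρ
    refine mem_heapOrdersWithMaxIn.2 ⟨isHeapOrder_removeBelow hρ hmin, fun x hx => ?_⟩
    rw [maxElements_removeBelow, mem_sdiff] at hx
    exact by_contra fun hxM => hx.2 (hmax (mem_filter.2 ⟨hx.1, hxM⟩))
  · exact fun σ hσ => removeBelow_addBelow (mem_heapOrdersWithMaxIn.1 hσ).1
  · intro ρ hρ
    simp only [coe_filter, Set.mem_ofPred_eq, mem_heapOrders, mem_Icc] at hρ
    exact addBelow_removeBelow hρ.1 hρ.2.2

theorem sum_Icc_neg_one_pow_card_of_ne {s t : Finset α} (hst : s ≠ t) :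
    ∑ u ∈ Icc s t, (-1 : ℤ) ^ #u = 0 := by
  by_cases hsub : s ⊆ t
  · have hinj : Set.InjOn (s ∪ ·) ((t \ s).powerset : Set (Finset α)) := by
      intro u hu w hw huw
      rw [mem_coe, mem_powerset, subset_sdiff] at hu hw
      rw [← union_sdiff_cancel_left hu.2.symm, ← union_sdiff_cancel_left hw.2.symm]
      exact congrArg (· \ s) huw
    have hcard : ∀ u ∈ (t \ s).powerset, (-1 : ℤ) ^ #(s ∪ u) = (-1) ^ #s * (-1) ^ #u := by
      intro u hu
      rw [card_union_of_disjoint (disjoint_sdiff.mono_right (mem_powerset.1 hu)), pow_add]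
    rw [Icc_eq_image_powerset hsub, sum_image hinj, sum_congr rfl hcard, ← mul_sum,
      sum_powerset_neg_one_pow_card_of_nonempty, mul_zero]
    exact sdiff_nonempty.2 fun hts => hst (hsub.antisymm hts)
  · rw [Icc_eq_empty hsub, sum_empty]

open scoped Classical in
theorem sum_antichains_neg_one_pow_mul_card_heapOrdersWithMaxIn [Std.Symm C] {M : Set α} {x : α}
    (hx : x ∈ V) (hxM : x ∈ M) :
    ∑ T ∈ antichains C V, (-1 : ℤ) ^ #T * #(heapOrdersWithMaxIn C (V \ T) M) = 0 := by
  -- Each order on `V` is counted once for every `T` between its set of maximal elements outside `M`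
  -- and its set of minimal elements, and these two sets differ.
  let admissible (ρ : Finset (α × α)) : Finset (Finset α) :=
    Icc {x ∈ maxElements V ρ | x ∉ M} (minElements V ρ)
  have hcount : ∀ T ∈ antichains C V, (-1 : ℤ) ^ #T * #(heapOrdersWithMaxIn C (V \ T) M) =
      ∑ ρ ∈ heapOrders C V with T ∈ admissible ρ, (-1) ^ #T := by
    intro T hT
    rw [card_heapOrdersWithMaxIn_sdiff (mem_antichains.1 hT).1 (mem_antichains.1 hT).2,
      sum_const, nsmul_eq_mul, mul_comm]
  have hswap : ∀ T ρ, T ∈ antichains C V ∧ ρ ∈ {ρ ∈ heapOrders C V | T ∈ admissible ρ} ↔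
      T ∈ admissible ρ ∧ ρ ∈ heapOrders C V := by
    intro T ρ
    simp only [mem_filter, mem_antichains, mem_heapOrders, admissible, mem_Icc]
    refine ⟨fun h => ⟨h.2.2, h.2.1⟩, fun ⟨hT, hρ⟩ => ⟨⟨?_, ?_⟩, hρ, hT⟩⟩
    · exact hT.2.trans (minElements_subset V ρ)
    · exact hρ.isAntichain_minElements.subset (coe_subset.2 hT.2)
  rw [sum_congr rfl hcount, sum_comm' hswap]
  exact sum_eq_zero fun ρ hρ => sum_Icc_neg_one_pow_card_of_ne
    ((mem_heapOrders.1 hρ).filter_maxElements_ne_minElements hx hxM)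

end HeapOrder

section UniformPartition

variable {α : Type*} [DecidableEq α] {r k m : ℕ} {A S : Finset α} {V T W : Finset (Finset α)}

/-- The family `V` is a partition of `A` into blocks of size `r`. -/
structure IsUniformPartition (r : ℕ) (A : Finset α) (V : Finset (Finset α)) : Prop where
  card_eq : ∀ b ∈ V, #b = r
  pairwiseDisjoint : (V : Set (Finset α)).PairwiseDisjoint id
  biUnion_eq : V.biUnion id = A

open scoped Classical in
/-- The finite set of all partitions of `A` into blocks of size `r`. -/
noncomputable def uniformPartitions (r : ℕ) (A : Finset α) : Finset (Finset (Finset α)) :=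
  {V ∈ A.powerset.powerset | IsUniformPartition r A V}

namespace IsUniformPartition

theorem subset (h : IsUniformPartition r A V) {b : Finset α} (hb : b ∈ V) : b ⊆ A :=
  h.biUnion_eq ▸ subset_biUnion_of_mem id hb

theorem exists_mem (h : IsUniformPartition r A V) {x : α} (hx : x ∈ A) : ∃ b ∈ V, x ∈ b := by
  simpa only [← h.biUnion_eq, mem_biUnion, id] using hx

theorem eq_of_mem (h : IsUniformPartition r A V) {b c : Finset α} {x : α} (hb : b ∈ V)
    (hc : c ∈ V) (hxb : x ∈ b) (hxc : x ∈ c) : b = c :=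
  h.pairwiseDisjoint.elim_finset hb hc x hxb hxc

theorem nonempty (hr : 1 ≤ r) (h : IsUniformPartition r A V) {b : Finset α} (hb : b ∈ V) :
    b.Nonempty :=
  card_pos.1 (h.card_eq b hb ▸ hr)

theorem mul_card (h : IsUniformPartition r A V) : r * #V = #A := by
  rw [← h.biUnion_eq, card_biUnion h.pairwiseDisjoint, mul_comm]
  exact (sum_const_nat h.card_eq).symm

theorem card (hr : 1 ≤ r) (h : IsUniformPartition r A V) (hA : #A = r * m) : #V = m :=
  Nat.eq_of_mul_eq_mul_left hr (h.mul_card.trans hA)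

theorem of_subset (h : IsUniformPartition r A V) (hT : T ⊆ V) :
    IsUniformPartition r (T.biUnion id) T where
  card_eq b hb := h.card_eq b (hT hb)
  pairwiseDisjoint := h.pairwiseDisjoint.subset (coe_subset.2 hT)
  biUnion_eq := rfl

theorem sdiff (h : IsUniformPartition r A V) (hT : T ⊆ V) :
    IsUniformPartition r (A \ T.biUnion id) (V \ T) := by
  have hdisj : Disjoint (T.biUnion id) ((V \ T).biUnion id) := by
    simp only [disjoint_biUnion_left, disjoint_biUnion_right, mem_sdiff]
    exact fun b hb c hc => h.pairwiseDisjoint (hT hc) hb.1 fun hcb => hb.2 (hcb ▸ hc)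
  have hrest : A \ T.biUnion id = (V \ T).biUnion id := by
    rw [← h.biUnion_eq, ← union_sdiff_of_subset hT, union_biUnion, union_sdiff_of_subset hT,
      union_sdiff_cancel_left hdisj]
  exact hrest ▸ h.of_subset sdiff_subset

theorem union (hS : S ⊆ A) (hT : IsUniformPartition r S T)
    (hW : IsUniformPartition r (A \ S) W) : IsUniformPartition r A (T ∪ W) where
  card_eq b hb := (mem_union.1 hb).elim (hT.card_eq b) (hW.card_eq b)
  pairwiseDisjoint := by
    rw [coe_union, Set.pairwiseDisjoint_union]
    refine ⟨hT.pairwiseDisjoint, hW.pairwiseDisjoint, fun b hb c hc _ => ?_⟩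
    exact disjoint_sdiff.mono (hT.subset hb) (hW.subset hc)
  biUnion_eq := by rw [union_biUnion, hT.biUnion_eq, hW.biUnion_eq, union_sdiff_of_subset hS]

theorem disjoint (hr : 1 ≤ r) (hT : IsUniformPartition r S T)
    (hW : IsUniformPartition r (A \ S) W) : Disjoint T W := by
  refine disjoint_left.2 fun b hbT hbW => (hT.nonempty hr hbT).ne_empty ?_
  exact disjoint_self.1 (disjoint_sdiff.mono (hT.subset hbT) (hW.subset hbW))

end IsUniformPartition

theorem mem_uniformPartitions : V ∈ uniformPartitions r A ↔ IsUniformPartition r A V := by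
  simp only [uniformPartitions, mem_filter, mem_powerset, and_iff_right_iff_imp]
  exact fun h b hb => mem_powerset.2 (h.subset hb)

/-- Choosing a partition of `A` and `k` of its blocks amounts to choosing the union `S` of these
blocks and partitioning `S` and its complement. -/
theorem sum_uniformPartitions_sum_powersetCard {M : Type*} [AddCommMonoid M] (hr : 1 ≤ r)
    (A : Finset α) (k : ℕ) (f : Finset (Finset α) → Finset (Finset α) → M) :
    ∑ V ∈ uniformPartitions r A, ∑ T ∈ powersetCard k V, f T (V \ T) =
      ∑ S ∈ powersetCard (r * k) A,
        ∑ T ∈ uniformPartitions r S, ∑ W ∈ uniformPartitions r (A \ S), f T W := by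
  simp only [← sum_product', sum_sigma']
  refine sum_nbij' (fun p => ⟨p.2.biUnion id, (p.2, p.1 \ p.2)⟩) (fun p => ⟨p.2.1 ∪ p.2.2, p.2.1⟩)
    ?_ ?_ ?_ ?_ fun _ _ => rfl
  · rintro ⟨V, T⟩ h
    simp only [mem_sigma, mem_uniformPartitions, mem_powersetCard, mem_product] at h ⊢
    obtain ⟨hV, hTV, hT⟩ := h
    have hsub := biUnion_subset_biUnion_of_subset_left id hTV
    exact ⟨⟨hV.biUnion_eq ▸ hsub, by rw [← (hV.of_subset hTV).mul_card, hT]⟩,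
      hV.of_subset hTV, hV.sdiff hTV⟩
  · rintro ⟨S, T, W⟩ h
    simp only [mem_sigma, mem_uniformPartitions, mem_powersetCard, mem_product] at h ⊢
    obtain ⟨⟨hSA, hS⟩, hT, hW⟩ := h
    exact ⟨hT.union hSA hW, subset_union_left, hT.card hr hS⟩
  · rintro ⟨V, T⟩ h
    simp only [mem_sigma, mem_powersetCard] at h
    simp only [union_sdiff_of_subset h.2.1]
  · rintro ⟨S, T, W⟩ h
    simp only [mem_sigma, mem_uniformPartitions, mem_product] at h
    simp only [h.2.1.biUnion_eq, union_sdiff_cancel_left (h.2.1.disjoint hr h.2.2)]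

theorem uniformPartitions_empty (hr : 1 ≤ r) :
    uniformPartitions r (∅ : Finset α) = {∅} := by
  ext V
  rw [mem_uniformPartitions, mem_singleton]
  constructor
  · exact fun h => card_eq_zero.1 (h.card hr (by simp))
  · rintro rfl
    exact ⟨by simp, by simp, by simp⟩

theorem uniformPartitions_of_card_eq (hr : 1 ≤ r) (hA : #A = r) :
    uniformPartitions r A = {{A}} := by
  ext V
  rw [mem_uniformPartitions, mem_singleton]
  constructor
  · intro h
    obtain ⟨b, rfl⟩ := card_eq_one.1 (h.card hr (by rw [hA, mul_one]))
    rw [← h.biUnion_eq, singleton_biUnion, id]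
  · rintro rfl
    exact ⟨by simp [hA], by simp, by simp⟩

theorem succ_mul_card_uniformPartitions (hr : 1 ≤ r) (hA : #A = r * (m + 1)) :
    (m + 1) * #(uniformPartitions r A) =
      ∑ S ∈ powersetCard r A, #(uniformPartitions r (A \ S)) := by
  have hsum := sum_uniformPartitions_sum_powersetCard hr A 1 fun _ _ => 1
  simp only [sum_const, card_powersetCard, smul_eq_mul, mul_one, Nat.choose_one_right] at hsum
  rw [mul_comm, ← sum_const_nat fun V hV => (mem_uniformPartitions.1 hV).card hr hA, hsum]
  refine sum_congr rfl fun S hS => ?_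
  rw [uniformPartitions_of_card_eq hr (mem_powersetCard.1 hS).2, card_singleton, one_mul]

theorem factorial_mul_card_uniformPartitions (hr : 1 ≤ r) (hA : #A = r * m) :
    m.factorial * #(uniformPartitions r A) * r.factorial ^ m = (r * m).factorial := by
  induction m generalizing A with
  | zero =>
    rw [mul_zero, card_eq_zero] at hA
    simp [hA, uniformPartitions_empty hr]
  | succ m ih =>
    have hrest : ∀ S ∈ powersetCard r A,
        m.factorial * #(uniformPartitions r (A \ S)) * r.factorial ^ m = (r * m).factorial := by
      intro S hS
      obtain ⟨hSA, hS⟩ := mem_powersetCard.1 hS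
      exact ih (by rw [card_sdiff_of_subset hSA, hA, hS, mul_add_one, Nat.add_sub_cancel])
    calc (m + 1).factorial * #(uniformPartitions r A) * r.factorial ^ (m + 1)
        = m.factorial * ((m + 1) * #(uniformPartitions r A)) * r.factorial ^ m * r.factorial := by
          rw [Nat.factorial_succ, pow_succ]
          ring
      _ = (∑ _S ∈ powersetCard r A, (r * m).factorial) * r.factorial := by
          rw [succ_mul_card_uniformPartitions hr hA, mul_sum, sum_mul, sum_congr rfl hrest]
      _ = (r * m + r).choose r * (r * m).factorial * r.factorial := by
          rw [sum_const, card_powersetCard, hA, smul_eq_mul, mul_add_one]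
      _ = (r * (m + 1)).factorial := by
          rw [Nat.add_choose_mul_factorial_mul_factorial, mul_add_one]

theorem uniformPartitions_nonempty (hr : 1 ≤ r) (hA : #A = r * m) :
    (uniformPartitions r A).Nonempty := by
  refine card_pos.1 (Nat.pos_of_ne_zero fun hzero => (r * m).factorial_ne_zero ?_)
  rw [← factorial_mul_card_uniformPartitions hr hA, hzero, mul_zero, zero_mul]

/-- A partition into blocks of size `r ≥ 1` as an element of Mathlib's lattice of partitions. -/
def IsUniformPartition.toFinpartition (h : IsUniformPartition r A V) (hr : 1 ≤ r) :
    Finpartition A where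
  parts := V
  supIndep := supIndep_iff_pairwiseDisjoint.2 h.pairwiseDisjoint
  sup_parts := by rw [sup_eq_biUnion, h.biUnion_eq]
  bot_notMem hV := (h.nonempty hr hV).ne_empty rfl

theorem IsUniformPartition.of_finpartition (π : Finpartition A) (hπ : ∀ b ∈ π.parts, #b = r) :
    IsUniformPartition r A π.parts where
  card_eq := hπ
  pairwiseDisjoint := π.disjoint
  biUnion_eq := π.biUnion_parts

theorem isMin_of_card_eq {π : {π : Finpartition A // ∀ b ∈ π.parts, r ∣ #b}}
    (hπ : ∀ b ∈ π.1.parts, #b = r) : IsMin π := by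
  intro τ hτ b hb
  obtain ⟨x, hx⟩ := π.1.nonempty_of_mem_parts hb
  obtain ⟨c, hc, hxc⟩ := τ.1.exists_mem (π.1.le hb hx)
  obtain ⟨b', hb', hcb⟩ := hτ hc
  obtain rfl : b = b' := π.1.eq_of_mem_parts hb hb' hx (hcb hxc)
  have hrc : r ≤ #c := Nat.le_of_dvd (card_pos.2 ⟨x, hxc⟩) (τ.2 c hc)
  exact ⟨c, hc, (eq_of_subset_of_card_le hcb (hπ b hb ▸ hrc)).ge⟩

theorem card_eq_of_isMin (hr : 1 ≤ r) {π : {π : Finpartition A // ∀ b ∈ π.parts, r ∣ #b}}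
    (hmin : IsMin π) : ∀ b ∈ π.1.parts, #b = r := by
  have hex : ∀ b ∈ π.1.parts, ∃ σ : Finpartition b, ∀ c ∈ σ.parts, #c = r := by
    intro b hb
    obtain ⟨m, hm⟩ := π.2 b hb
    obtain ⟨T, hT⟩ := uniformPartitions_nonempty hr hm
    rw [mem_uniformPartitions] at hT
    exact ⟨hT.toFinpartition hr, hT.card_eq⟩
  choose σ hσ using hex
  have hcard : ∀ c ∈ (π.1.bind σ).parts, #c = r := by
    intro c hc
    obtain ⟨b, hb, hcb⟩ := Finpartition.mem_bind.1 hc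
    exact hσ b hb c hcb
  have hle : ⟨π.1.bind σ, fun c hc => (hcard c hc).symm ▸ dvd_rfl⟩ ≤ π := by
    intro c hc
    obtain ⟨b, hb, hcb⟩ := Finpartition.mem_bind.1 hc
    exact ⟨b, hb, (σ b hb).le hcb⟩
  exact hmin.eq_of_le hle ▸ hcard

theorem card_isMin (hr : 1 ≤ r) (A : Finset α) :
    Nat.card {π : {π : Finpartition A // ∀ b ∈ π.parts, r ∣ #b} // IsMin π} =
      #(uniformPartitions r A) := by
  rw [← Nat.card_eq_finsetCard]
  refine Nat.card_congr
    { toFun π := ⟨π.1.1.parts, mem_uniformPartitions.2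
        (.of_finpartition π.1.1 (card_eq_of_isMin hr π.2))⟩
      invFun V :=
        have hV := mem_uniformPartitions.1 V.2
        ⟨⟨hV.toFinpartition hr, fun b hb => (hV.card_eq b hb).symm ▸ dvd_rfl⟩,
          isMin_of_card_eq hV.card_eq⟩ }

theorem factorial_mul_numMinimal_divPartition (hr : 1 ≤ r) (k : ℕ) :
    k.factorial * numMinimal (fun k => DivPartition r k) k * r.factorial ^ k =
      (r * k).factorial := by
  have hcard : #(Icc 1 (r * k)) = r * k := by rw [Nat.card_Icc, Nat.add_sub_cancel]
  rcases eq_or_ne k 0 with rfl | hk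
  · simp [numMinimal]
  · rw [numMinimal, if_neg hk, card_isMin hr, factorial_mul_card_uniformPartitions hr hcard]

end UniformPartition

section Crossing

variable {α : Type*} [LinearOrder α] {r k : ℕ} {S B D : Finset α} {T : Finset (Finset α)}

/-- Two finite sets cross unless one of them lies entirely to the left of the other; this is the
relation `Crossing` for sets of arbitrary size in a linear order. -/
def SetCrossing (s t : Finset α) : Prop :=
  ¬ ((∀ i ∈ s, ∀ j ∈ t, i < j) ∨ (∀ j ∈ t, ∀ i ∈ s, j < i))

instance : Std.Symm (SetCrossing (α := α)) where
  symm _ _ h h' := h h'.symm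

theorem exists_initial_subset (S : Finset α) (hk : k ≤ #S) :
    ∃ B ⊆ S, #B = k ∧ ∀ x ∈ B, ∀ y ∈ S \ B, x < y := by
  induction S using Finset.induction_on_max with
  | empty => exact ⟨∅, by simpa using (Nat.le_zero.1 hk).symm⟩
  | insert a S ha ih =>
    have haS : a ∉ S := fun h => (ha a h).false
    rcases hk.eq_or_lt with rfl | hlt
    · exact ⟨insert a S, Subset.rfl, rfl, by simp⟩
    · rw [card_insert_of_notMem haS, Nat.lt_succ_iff] at hlt
      obtain ⟨B, hBS, hB, hBlt⟩ := ih hlt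
      refine ⟨B, hBS.trans (subset_insert a S), hB, fun x hx y hy => ?_⟩
      rw [insert_sdiff_of_notMem _ fun h => haS (hBS h), mem_insert] at hy
      rcases hy with rfl | hy
      exacts [ha x (hBS hx), hBlt x hx y hy]

theorem eq_of_initial (hB : B ⊆ S) (hD : D ⊆ S) (hcard : #B = #D)
    (hBlt : ∀ x ∈ B, ∀ y ∈ S \ B, x < y) (hDlt : ∀ x ∈ D, ∀ y ∈ S \ D, x < y) : B = D := by
  refine eq_of_subset_of_card_le (fun x hx => ?_) hcard.ge
  by_contra hxD
  obtain ⟨y, hy, hyB⟩ : ∃ y ∈ D, y ∉ B :=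
    not_subset.1 fun h => hxD (eq_of_subset_of_card_le h hcard.le ▸ hx)
  exact lt_asymm (hBlt x hx y (mem_sdiff.2 ⟨hD hy, hyB⟩)) (hDlt y hy x (mem_sdiff.2 ⟨hB hx, hxD⟩))

theorem isUniformPartition_singleton (B : Finset α) : IsUniformPartition #B B {B} where
  card_eq := by simp
  pairwiseDisjoint := by simp
  biUnion_eq := singleton_biUnion

theorem IsUniformPartition.isAntichain_insert (hT : IsUniformPartition r (S \ B) T)
    (hanti : IsAntichain SetCrossing (T : Set (Finset α))) (hB : ∀ x ∈ B, ∀ y ∈ S \ B, x < y) :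
    IsAntichain SetCrossing ((insert B T : Finset (Finset α)) : Set (Finset α)) := by
  rw [coe_insert, isAntichain_insert_of_symm]
  exact ⟨hanti, fun c hc _ h => h (.inl fun i hi j hj => hB i hi j (hT.subset hc hj))⟩

theorem IsUniformPartition.exists_initial_mem (hT : IsUniformPartition r S T)
    (hanti : IsAntichain SetCrossing (T : Set (Finset α))) (hS : S.Nonempty) :
    ∃ b ∈ T, ∀ x ∈ b, ∀ y ∈ S \ b, x < y := by
  -- The block of the minimum of `S` has no block to its left.
  obtain ⟨b, hb, hmin⟩ := hT.exists_mem (S.min'_mem hS)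
  refine ⟨b, hb, fun x hx y hy => ?_⟩
  obtain ⟨hyS, hyb⟩ := mem_sdiff.1 hy
  obtain ⟨c, hc, hyc⟩ := hT.exists_mem hyS
  have hbc : b ≠ c := fun h => hyb (h ▸ hyc)
  rcases not_not.1 (hanti hb hc hbc) with h | h
  · exact h x hx y hyc
  · exact absurd (h y hyc _ hmin) (min'_le S y hyS).not_gt

theorem existsUnique_isUniformPartition_isAntichain (hr : 1 ≤ r) (hS : #S = r * k) :
    ∃! T, IsUniformPartition r S T ∧ IsAntichain SetCrossing (T : Set (Finset α)) := by
  induction k generalizing S with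
  | zero =>
    rw [mul_zero, card_eq_zero] at hS
    simp only [← mem_uniformPartitions, hS, uniformPartitions_empty hr, mem_singleton]
    exact ⟨∅, by simp, fun T hT => hT.1⟩
  | succ k ih =>
    rw [mul_add_one] at hS
    obtain ⟨B, hBS, rfl, hBlt⟩ := exists_initial_subset S (k := r) (hS ▸ Nat.le_add_left _ _)
    obtain ⟨T₀, ⟨hT₀, hanti₀⟩, huniq⟩ := ih (S := S \ B) (by
      rw [card_sdiff_of_subset hBS, hS, Nat.add_sub_cancel])
    refine ⟨insert B T₀, ⟨?_, hT₀.isAntichain_insert hanti₀ hBlt⟩, ?_⟩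
    · exact (isUniformPartition_singleton B).union hBS hT₀
    · rintro T ⟨hT, hanti⟩
      obtain ⟨b, hb, hblt⟩ := hT.exists_initial_mem hanti ((card_pos.1 hr).mono hBS)
      obtain rfl : B = b := eq_of_initial hBS (hT.subset hb) (hT.card_eq b hb).symm hBlt hblt
      have hrest := hT.sdiff (singleton_subset_iff.2 hb)
      rw [singleton_biUnion, id] at hrest
      rw [← huniq _ ⟨hrest, hanti.subset (coe_subset.2 sdiff_subset)⟩, insert_eq,
        union_sdiff_of_subset (singleton_subset_iff.2 hb)]

end Crossing

section PyramidCount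

variable {α : Type*} [LinearOrder α] {r m : ℕ} {A : Finset α} {a : α}

/-- The number of pyramids on `A` whose pieces are the blocks of a partition of `A` into blocks of
size `r` and whose top piece contains `a`. A block that contains `a` is unique, so these are the
heaps whose maximal elements all contain `a`. -/
noncomputable def pyramidCount (r : ℕ) (A : Finset α) (a : α) : ℕ :=
  ∑ W ∈ uniformPartitions r A, #(heapOrdersWithMaxIn SetCrossing W {b | a ∈ b})

theorem heapOrdersWithMaxIn_empty (C : Finset α → Finset α → Prop) (M : Set (Finset α)) :
    heapOrdersWithMaxIn C ∅ M = {∅} := by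
  ext ρ
  rw [mem_heapOrdersWithMaxIn, mem_singleton]
  constructor
  · exact fun h => eq_empty_of_forall_notMem fun p hp => notMem_empty _ (h.1.mem hp).1
  · rintro rfl
    exact ⟨by constructor <;> simp, fun x hx => absurd (mem_maxElements.1 hx).1 (notMem_empty x)⟩

theorem pyramidCount_empty (hr : 1 ≤ r) (a : α) : pyramidCount r ∅ a = 1 := by
  rw [pyramidCount, uniformPartitions_empty hr, sum_singleton, heapOrdersWithMaxIn_empty,
    card_singleton]

theorem pyramidCount_of_notMem (hA : A.Nonempty) (ha : a ∉ A) : pyramidCount r A a = 0 := by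
  refine sum_eq_zero fun W hW => card_eq_zero.2 (eq_empty_of_forall_notMem fun ρ hρ => ha ?_)
  rw [mem_uniformPartitions] at hW
  rw [mem_heapOrdersWithMaxIn] at hρ
  obtain ⟨x, hx⟩ := hA
  obtain ⟨b, hb, -⟩ := hW.exists_mem hx
  obtain ⟨t, ht, -⟩ := hρ.1.exists_le_maxElements hb
  exact hW.subset (mem_maxElements.1 ht).1 (hρ.2 t ht)

open scoped Classical in
theorem sum_isAntichain_neg_one_pow_card (hr : 1 ≤ r) {S : Finset α} {k : ℕ} (hS : #S = r * k) :
    ∑ T ∈ uniformPartitions r S,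
      (if IsAntichain SetCrossing (T : Set (Finset α)) then (-1 : ℤ) ^ #T else 0) = (-1) ^ k := by
  obtain ⟨T₀, ⟨hT₀, hanti⟩, huniq⟩ := existsUnique_isUniformPartition_isAntichain hr hS
  rw [sum_eq_single_of_mem T₀ (mem_uniformPartitions.2 hT₀), if_pos hanti, hT₀.card hr hS]
  exact fun T hT hne => if_neg fun h => hne (huniq T ⟨mem_uniformPartitions.1 hT, h⟩)

theorem sum_powersetCard_pyramidCount_sdiff (hr : 1 ≤ r) (ha : a ∈ A) (hA : #A = r * m) :
    ∑ k ∈ range (m + 1),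
      (-1 : ℤ) ^ k * ∑ S ∈ powersetCard (r * k) A, (pyramidCount r (A \ S) a : ℤ) = 0 := by
  classical
  let weight (T W : Finset (Finset α)) : ℤ :=
    (if IsAntichain SetCrossing (T : Set (Finset α)) then (-1) ^ #T else 0) *
      #(heapOrdersWithMaxIn SetCrossing W {b | a ∈ b})
  have hinversion : ∀ V ∈ uniformPartitions r A, ∑ T ∈ V.powerset, weight T (V \ T) = 0 := by
    intro V hV
    obtain ⟨b, hb, hab⟩ := (mem_uniformPartitions.1 hV).exists_mem ha
    rw [← sum_antichains_neg_one_pow_mul_card_heapOrdersWithMaxIn (C := SetCrossing)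
      (M := {b | a ∈ b}) hb hab, antichains, sum_filter]
    simp only [weight, ite_mul, zero_mul]
  have hcut : ∀ k, ∀ S ∈ powersetCard (r * k) A,
      ∑ T ∈ uniformPartitions r S, ∑ W ∈ uniformPartitions r (A \ S), weight T W =
        (-1) ^ k * (pyramidCount r (A \ S) a : ℤ) := by
    intro k S hS
    rw [pyramidCount, Nat.cast_sum, ← sum_isAntichain_neg_one_pow_card hr (mem_powersetCard.1 hS).2,
      sum_mul_sum]
  calc _ = ∑ k ∈ range (m + 1), ∑ V ∈ uniformPartitions r A,
        ∑ T ∈ powersetCard k V, weight T (V \ T) := by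
        refine sum_congr rfl fun k _ => ?_
        rw [sum_uniformPartitions_sum_powersetCard hr, sum_congr rfl (hcut k), mul_sum]
    _ = ∑ V ∈ uniformPartitions r A, ∑ T ∈ V.powerset, weight T (V \ T) := by
        rw [sum_comm]
        refine sum_congr rfl fun V hV => ?_
        rw [sum_powerset, (mem_uniformPartitions.1 hV).card hr hA]
    _ = 0 := sum_eq_zero hinversion

theorem sum_powersetCard_erase_pyramidCount_sdiff (hr : 1 ≤ r) (ha : a ∈ A) (hA : #A = r * m) :
    ∑ k ∈ range m, (-1 : ℤ) ^ k *
      ∑ S ∈ powersetCard (r * k) (A.erase a), (pyramidCount r (A \ S) a : ℤ) =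
        (-1) ^ (m + 1) := by
  have hsum := sum_powersetCard_pyramidCount_sdiff hr ha hA
  have herase : ∀ k ∈ range m, ∑ S ∈ powersetCard (r * k) (A.erase a),
      (pyramidCount r (A \ S) a : ℤ) =
        ∑ S ∈ powersetCard (r * k) A, (pyramidCount r (A \ S) a : ℤ) := by
    intro k hk
    refine sum_subset (powersetCard_mono (erase_subset a A)) fun S hS hSa => ?_
    rw [mem_powersetCard] at hS hSa
    have haS : a ∈ S := by_contra fun haS => hSa ⟨subset_erase.2 ⟨hS.1, haS⟩, hS.2⟩
    have hlt : #S < #A := by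
      rw [hS.2, hA]
      exact Nat.mul_lt_mul_of_pos_left (mem_range.1 hk) hr
    have hne : (A \ S).Nonempty := sdiff_nonempty.2 fun hAS => (card_le_card hAS).not_gt hlt
    rw [pyramidCount_of_notMem hne fun h => (mem_sdiff.1 h).2 haS, Nat.cast_zero]
  rw [sum_range_succ, ← hA, powersetCard_self, sum_singleton, sdiff_self,
    bot_eq_empty, pyramidCount_empty hr, Nat.cast_one] at hsum
  rw [sum_congr rfl fun k hk => congrArg _ (herase k hk), pow_succ]
  linarith

theorem pyramidCount_eq (hr : 1 ≤ r) {c : ℕ → ℚ}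
    (hc : ∀ m, 1 ≤ m → ∑ k ∈ range m, (-1) ^ k * (r * m - 1).choose (r * k) * c (m - k) =
      (-1) ^ (m + 1))
    (ha : a ∈ A) (hA : #A = r * m) : (pyramidCount r A a : ℚ) = c m := by
  induction m using Nat.strong_induction_on generalizing A with
  | _ m ih =>
  obtain ⟨n, rfl⟩ : ∃ n, m = n + 1 :=
    Nat.exists_eq_succ_of_ne_zero fun hm => by simp [card_eq_zero.1 (hA.trans (by simp [hm]))] at ha
  have hrec : ∑ k ∈ range (n + 1), (-1 : ℚ) ^ k *
      ∑ S ∈ powersetCard (r * k) (A.erase a), (pyramidCount r (A \ S) a : ℚ) =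
        (-1) ^ (n + 1 + 1) := by
    exact_mod_cast sum_powersetCard_erase_pyramidCount_sdiff hr ha hA
  have hsmaller : ∀ k, ∑ S ∈ powersetCard (r * (k + 1)) (A.erase a),
      (pyramidCount r (A \ S) a : ℚ) =
        (r * (n + 1) - 1).choose (r * (k + 1)) * c (n + 1 - (k + 1)) := by
    intro k
    have hcongr : ∀ S ∈ powersetCard (r * (k + 1)) (A.erase a),
        (pyramidCount r (A \ S) a : ℚ) = c (n + 1 - (k + 1)) := by
      intro S hS
      obtain ⟨hSA, hS⟩ := mem_powersetCard.1 hS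
      obtain ⟨hSA, haS⟩ := subset_erase.1 hSA
      refine ih _ (Nat.sub_lt n.succ_pos k.succ_pos) (mem_sdiff.2 ⟨ha, haS⟩) ?_
      rw [card_sdiff_of_subset hSA, hA, hS, Nat.mul_sub]
    rw [sum_congr rfl hcongr, sum_const, card_powersetCard, card_erase_of_mem ha, hA, nsmul_eq_mul]
  have hcn := hc (n + 1) (Nat.le_add_left 1 n)
  rw [sum_range_succ'] at hrec hcn
  rw [sum_congr rfl fun k _ => congrArg _ (hsmaller k), ← hcn] at hrec
  simpa [mul_assoc] using hrec

end PyramidCount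

section LogarithmicDerivative

open PowerSeries

theorem mul_derivative_logOf {f : ℚ⟦X⟧} (hf : constantCoeff f = 1) :
    f * derivative ℚ (logOf f) = derivative ℚ f := by
  have hsubst : HasSubst (f - 1) := HasSubst.of_constantCoeff_zero' (by simp [hf])
  have hlog : (1 + X) * derivative ℚ (log ℚ) = 1 := by
    rw [deriv_log, add_mul, one_mul]
    ext n
    cases n with
    | zero => simp
    | succ n => simp [coeff_succ_X_mul, coeff_one, pow_succ]
  have hinv : f * (derivative ℚ (log ℚ)).subst (f - 1) = 1 := by
    have h := congrArg (substAlgHom hsubst) hlog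
    rwa [map_mul, map_add, map_one, substAlgHom_X, coe_substAlgHom, add_sub_cancel] at h
  rw [logOf_eq, derivative_subst hsubst, ← mul_assoc, hinv, one_mul, map_sub, derivative_one,
    sub_zero]

variable (Q : ℕ → Type*) [∀ n, PartialOrder (Q n)]

theorem constantCoeff_signedSeries : constantCoeff (signedSeries Q) = 1 := by
  rw [← coeff_zero_eq_constantCoeff_apply, signedSeries, coeff_mk]
  simp [numMinimal]

variable {Q}

theorem sum_antidiagonal_mul_rNumber (hM : ∀ n, numMinimal Q n ≠ 0) (m : ℕ) :
    ∑ p ∈ antidiagonal m, (-1) ^ p.1 / ((p.1.factorial : ℚ) * numMinimal Q p.1) *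
      (rNumber Q p.2 / ((p.2.factorial : ℚ) * numMinimal Q p.2) * p.2) =
        (-1) ^ (m + 1) / ((m.factorial : ℚ) * numMinimal Q m) * m := by
  have hcoeff : ∀ k, rNumber Q k / ((k.factorial : ℚ) * numMinimal Q k) =
      -coeff k (logOf (signedSeries Q)) := by
    intro k
    have hk : (k.factorial : ℚ) * numMinimal Q k ≠ 0 :=
      mul_ne_zero (by exact_mod_cast k.factorial_ne_zero) (by exact_mod_cast hM k)
    rw [rNumber, mul_div_cancel_left₀ _ hk, map_neg]
  cases m with
  | zero => simp
  | succ n =>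
    have h := congrArg (coeff n) (mul_derivative_logOf (constantCoeff_signedSeries Q))
    simp only [coeff_mul, coeff_derivative] at h
    simp only [Nat.sum_antidiagonal_succ', hcoeff, Nat.cast_zero, mul_zero, zero_add, neg_mul,
      mul_neg, sum_neg_distrib, Nat.cast_add_one]
    simp only [signedSeries, coeff_mk] at h ⊢
    rw [h, pow_succ (-1 : ℚ) (n + 1)]
    ring

theorem choose_pred_mul_mul_cast {r m k : ℕ} (hr : 1 ≤ r) (hm : 1 ≤ m) (hk : k ≤ m) :
    ((r * m - 1).choose (r * k) : ℚ) * m =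
      (r * m).factorial / ((r * k).factorial * (r * (m - k)).factorial) * (m - k : ℕ) := by
  have hrm : r * m - 1 + 1 = r * m := Nat.sub_add_cancel (Nat.mul_pos hr hm)
  have h := Nat.choose_mul_succ_eq (r * m - 1) (r * k)
  rw [hrm, ← Nat.mul_sub] at h
  rw [Nat.mul_sub, ← Nat.cast_choose ℚ (Nat.mul_le_mul_left r hk)]
  refine mul_left_cancel₀ (a := (r : ℚ)) (by positivity) ?_
  rw [mul_left_comm, mul_left_comm (r : ℚ)]
  exact_mod_cast h

theorem sum_choose_mul_rNumber {r : ℕ} (hr : 1 ≤ r)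
    (hQ : ∀ k, k.factorial * numMinimal Q k * r.factorial ^ k = (r * k).factorial)
    {m : ℕ} (hm : 1 ≤ m) :
    ∑ k ∈ range m, (-1 : ℚ) ^ k * (r * m - 1).choose (r * k) * rNumber Q (m - k) =
      (-1) ^ (m + 1) := by
  have hM : ∀ k, numMinimal Q k ≠ 0 := fun k hk =>
    (r * k).factorial_ne_zero (by rw [← hQ, hk, mul_zero, zero_mul])
  have hw : ∀ k, (k.factorial : ℚ) * numMinimal Q k =
      (r * k).factorial / (r.factorial : ℚ) ^ k := by
    intro k
    rw [eq_div_iff (by positivity)]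
    exact_mod_cast hQ k
  have hsum := sum_antidiagonal_mul_rNumber hM m
  rw [Nat.sum_antidiagonal_eq_sum_range_succ_mk, sum_range_succ, Nat.sub_self, Nat.cast_zero,
    mul_zero, mul_zero, add_zero] at hsum
  have hw0 : (m.factorial : ℚ) * numMinimal Q m ≠ 0 := by
    rw [hw]
    positivity
  refine mul_right_cancel₀ (b := m / ((m.factorial : ℚ) * numMinimal Q m)) (by positivity) ?_
  refine Eq.trans ?_ (hsum.trans (by ring))
  rw [sum_mul]
  refine sum_congr rfl fun k hk => ?_
  have hkm := (mem_range.1 hk).le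
  have hpow : (r.factorial : ℚ) ^ m = (r.factorial : ℚ) ^ k * (r.factorial : ℚ) ^ (m - k) := by
    rw [← pow_add, Nat.add_sub_cancel' hkm]
  calc _ = (-1 : ℚ) ^ k * ((r * m - 1).choose (r * k) * m) * rNumber Q (m - k) /
        ((m.factorial : ℚ) * numMinimal Q m) := by ring
    _ = _ := by
      rw [choose_pred_mul_mul_cast hr hm hkm, hw, hw, hw, hpow]
      field_simp

end LogarithmicDerivative

section HeapsFromOrders

variable {α : Type} {C : α → α → Prop} {V V' : Finset α} {ρ ρ' : Finset (α × α)}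

theorem IsHeapOrder.rel_of_covBy (h : IsHeapOrder C V ρ) {x y : h.Elements} (hxy : x ⋖ y) :
    C x.val y.val := by
  obtain ⟨z, hxz, hne, hxz', hzy⟩ := h.step hxy.le fun heq => hxy.ne (Elements.ext heq)
  let z' : h.Elements := ⟨z, (h.mem hzy).1⟩
  have hlt : x < z' := lt_of_le_of_ne hxz' fun heq => hne (congrArg Elements.val heq)
  have heq : z' = y := (eq_or_lt_of_le (show z' ≤ y from hzy)).resolve_right (hxy.2 hlt)
  exact heq ▸ hxz

variable {p : α → Prop} {R : {a // p a} → {a // p a} → Prop}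

/-- The heap given by a heap order whose elements are pieces. -/
def IsHeapOrder.toHeap (h : IsHeapOrder C V ρ) (hR : ∀ b c, R b c ↔ C b.1 c.1)
    (hV : ∀ b ∈ V, p b) : Heap R where
  carrier := h.Elements
  label x := ⟨x.val, hV x.val x.mem⟩
  comparable x y hxy := h.comparable x.mem y.mem ((hR _ _).1 hxy)
  covBy_rel _ _ hxy := (hR _ _).2 (h.rel_of_covBy hxy)

theorem IsHeapOrder.subset_of_iso_toHeap {h : IsHeapOrder C V ρ} {h' : IsHeapOrder C V' ρ'}
    {hR : ∀ b c, R b c ↔ C b.1 c.1} {hV : ∀ b ∈ V, p b} {hV' : ∀ b ∈ V', p b}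
    (hiso : (h.toHeap hR hV).Iso (h'.toHeap hR hV')) : V ⊆ V' ∧ ρ ⊆ ρ' := by
  obtain ⟨e, he⟩ := hiso
  have hval : ∀ x : h.Elements, (e x).val = x.val := fun x => congrArg Subtype.val (he x)
  constructor
  · intro b hb
    have hmem : (e ⟨b, hb⟩).val ∈ V' := (e ⟨b, hb⟩).mem
    rwa [hval] at hmem
  · rintro ⟨b, c⟩ hbc
    let x : h.Elements := ⟨b, (h.mem hbc).1⟩
    let y : h.Elements := ⟨c, (h.mem hbc).2⟩
    have hle : ((e x).val, (e y).val) ∈ ρ' := e.monotone (show x ≤ y from hbc)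
    rwa [hval, hval] at hle

/-- The order on the labels of a heap induced by the order on its elements; meant for heaps with
pairwise distinct labels. -/
noncomputable def labelOrder (H : Heap R) : Finset (α × α) :=
  (Set.toFinite ((fun q : H.carrier × H.carrier => ((H.label q.1).1, (H.label q.2).1)) ''
    {q | q.1 ≤ q.2})).toFinset

theorem mem_labelOrder {H : Heap R} {b c : α} :
    (b, c) ∈ labelOrder H ↔ ∃ x y, x ≤ y ∧ (H.label x).1 = b ∧ (H.label y).1 = c := by
  simp [labelOrder]

theorem label_mem_labelOrder {H : Heap R} (hinj : Function.Injective H.label) {x y : H.carrier} :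
    ((H.label x).1, (H.label y).1) ∈ labelOrder H ↔ x ≤ y := by
  rw [mem_labelOrder]
  constructor
  · rintro ⟨x', y', hle, hx, hy⟩
    rwa [← hinj (Subtype.ext hx), ← hinj (Subtype.ext hy)]
  · exact fun hle => ⟨x, y, hle, rfl, rfl⟩

theorem isHeapOrder_labelOrder (hR : ∀ b c, R b c ↔ C b.1 c.1) {H : Heap R}
    (hinj : Function.Injective H.label) (hV : ∀ b, b ∈ V ↔ ∃ x, (H.label x).1 = b) :
    IsHeapOrder C V (labelOrder H) where
  mem b c hbc := by
    obtain ⟨x, y, -, hx, hy⟩ := mem_labelOrder.1 hbc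
    exact ⟨(hV b).2 ⟨x, hx⟩, (hV c).2 ⟨y, hy⟩⟩
  refl b hb := by
    obtain ⟨x, rfl⟩ := (hV b).1 hb
    exact (label_mem_labelOrder hinj).2 le_rfl
  trans b c d hbc hcd := by
    obtain ⟨x, y, hxy, rfl, rfl⟩ := mem_labelOrder.1 hbc
    obtain ⟨y', z, hyz, hy', rfl⟩ := mem_labelOrder.1 hcd
    obtain rfl := hinj (Subtype.ext hy')
    exact (label_mem_labelOrder hinj).2 (hxy.trans hyz)
  antisymm b c hbc hcb := by
    obtain ⟨x, y, hxy, rfl, rfl⟩ := mem_labelOrder.1 hbc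
    rw [hxy.antisymm ((label_mem_labelOrder hinj).1 hcb)]
  comparable b c hb hc hbc := by
    obtain ⟨x, rfl⟩ := (hV b).1 hb
    obtain ⟨y, rfl⟩ := (hV c).1 hc
    simp only [label_mem_labelOrder hinj]
    exact H.comparable x y ((hR _ _).2 hbc)
  step b c hbc hne := by
    obtain ⟨x, y, hxy, rfl, rfl⟩ := mem_labelOrder.1 hbc
    obtain ⟨z, hxz, hzy⟩ := exists_covBy_le_of_lt (hxy.lt_of_ne fun heq => hne (heq ▸ rfl))
    exact ⟨(H.label z).1, (hR _ _).1 (H.covBy_rel x z hxz),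
      fun heq => hxz.ne (hinj (Subtype.ext heq)), (label_mem_labelOrder hinj).2 hxz.le,
      (label_mem_labelOrder hinj).2 hzy⟩

theorem iso_toHeap_labelOrder (hR : ∀ b c, R b c ↔ C b.1 c.1) {H : Heap R}
    (hinj : Function.Injective H.label) (hV : ∀ b, b ∈ V ↔ ∃ x, (H.label x).1 = b)
    (hVp : ∀ b ∈ V, p b) : H.Iso ((isHeapOrder_labelOrder hR hinj hV).toHeap hR hVp) := by
  let f (x : H.carrier) : (isHeapOrder_labelOrder hR hinj hV).Elements :=
    ⟨(H.label x).1, (hV _).2 ⟨x, rfl⟩⟩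
  have hf : Function.Bijective f := by
    refine ⟨fun x y hxy => hinj (Subtype.ext (congrArg IsHeapOrder.Elements.val hxy)), fun b => ?_⟩
    obtain ⟨x, hx⟩ := (hV b.val).1 b.mem
    exact ⟨x, IsHeapOrder.Elements.ext hx⟩
  exact ⟨⟨.ofBijective f hf, label_mem_labelOrder hinj⟩, fun _ => rfl⟩

end HeapsFromOrders

section BlockPyramids

variable {r n : ℕ} {W : Finset (Finset ℕ)} {ρ : Finset (Finset ℕ × Finset ℕ)}

theorem IsUniformPartition.card_eq_and_one_le (hW : IsUniformPartition r (Icc 1 (r * n)) W) :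
    ∀ b ∈ W, #b = r ∧ ∀ i ∈ b, 1 ≤ i :=
  fun b hb => ⟨hW.card_eq b hb, fun _ hi => (mem_Icc.1 (hW.subset hb hi)).1⟩

/-- The heap of `r`-blocks given by a heap order on the blocks of a partition of `[rn]`. -/
def blockHeap (hW : IsUniformPartition r (Icc 1 (r * n)) W) (h : IsHeapOrder SetCrossing W ρ) :
    Heap (Crossing (r := r)) :=
  h.toHeap (fun _ _ => Iff.rfl) hW.card_eq_and_one_le

theorem mk_blockHeap_mem_blockPyramids (hr : 1 ≤ r) (hn : 1 ≤ n)
    (hW : IsUniformPartition r (Icc 1 (r * n)) W)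
    (hρ : ρ ∈ heapOrdersWithMaxIn SetCrossing W {b | r * n ∈ b}) :
    Quotient.mk _ (blockHeap hW (mem_heapOrdersWithMaxIn.1 hρ).1) ∈ blockPyramids r n := by
  obtain ⟨h, hmax⟩ := mem_heapOrdersWithMaxIn.1 hρ
  refine ⟨_, rfl, ?_, ?_, ⟨⟨hW.toFinpartition hr, hW.card_eq⟩, ?_, ?_⟩, ?_⟩
  · obtain ⟨b, hb, -⟩ := hW.exists_mem (right_mem_Icc.2 (Nat.mul_pos hr hn))
    obtain ⟨t, ht, -⟩ := h.exists_le_maxElements hb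
    refine ⟨(⟨t, (mem_maxElements.1 ht).1⟩ : h.Elements), h.isMax_iff.2 ht, fun y hy => ?_⟩
    have hy' := h.isMax_iff.1 hy
    exact IsHeapOrder.Elements.ext (hW.eq_of_mem (mem_maxElements.1 hy').1
      (mem_maxElements.1 ht).1 (hmax _ hy') (hmax _ ht))
  · exact (Nat.card_congr h.elementsEquiv).trans
      ((Nat.card_eq_finsetCard W).trans (hW.card hr (Nat.card_Icc 1 (r * n))))
  · exact fun x y hxy => IsHeapOrder.Elements.ext (congrArg Subtype.val hxy)
  · exact fun b => ⟨fun hb => ⟨(⟨b, hb⟩ : h.Elements), rfl⟩, fun ⟨x, hx⟩ => hx ▸ x.mem⟩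
  · exact fun t ht => hmax _ (h.isMax_iff.1 ht)

theorem exists_mk_blockHeap_eq {q : HeapClass (Crossing (r := r))} (hq : q ∈ blockPyramids r n) :
    ∃ W ρ, ∃ hW : IsUniformPartition r (Icc 1 (r * n)) W,
      ∃ hρ : ρ ∈ heapOrdersWithMaxIn SetCrossing W {b | r * n ∈ b},
        Quotient.mk _ (blockHeap hW (mem_heapOrdersWithMaxIn.1 hρ).1) = q := by
  obtain ⟨H, rfl, -, -, ⟨π, hinj, hblocks⟩, hmax⟩ := hq
  have hW := IsUniformPartition.of_finpartition π.1 π.2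
  have h := isHeapOrder_labelOrder (C := SetCrossing) (fun _ _ => Iff.rfl) hinj hblocks
  have hiso : H.Iso (blockHeap hW h) :=
    iso_toHeap_labelOrder (C := SetCrossing) (fun _ _ => Iff.rfl) hinj hblocks hW.card_eq_and_one_le
  have hmaxIn : labelOrder H ∈ heapOrdersWithMaxIn SetCrossing π.1.parts {b | r * n ∈ b} := by
    refine mem_heapOrdersWithMaxIn.2 ⟨h, fun b hb => ?_⟩
    obtain ⟨x, rfl⟩ := (hblocks b).1 (mem_maxElements.1 hb).1
    refine hmax x fun y hxy => ?_
    have hyx := (mem_maxElements.1 hb).2 _ ((label_mem_labelOrder hinj).2 hxy)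
    exact (hinj (Subtype.ext hyx)).le
  exact ⟨π.1.parts, labelOrder H, hW, hmaxIn, (Quotient.sound hiso).symm⟩

theorem finite_blockPyramids_and_ncard (hr : 1 ≤ r) (hn : 1 ≤ n) :
    (blockPyramids r n).Finite ∧
      (blockPyramids r n).ncard = pyramidCount r (Icc 1 (r * n)) (r * n) := by
  let D : Finset (Σ _ : Finset (Finset ℕ), Finset (Finset ℕ × Finset ℕ)) :=
    (uniformPartitions r (Icc 1 (r * n))).sigma
      fun W => heapOrdersWithMaxIn SetCrossing W {b | r * n ∈ b}
  have hpart (d : D) : IsUniformPartition r (Icc 1 (r * n)) d.1.1 :=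
    mem_uniformPartitions.1 (mem_sigma.1 d.2).1
  have hord (d : D) : d.1.2 ∈ heapOrdersWithMaxIn SetCrossing d.1.1 {b | r * n ∈ b} :=
    (mem_sigma.1 d.2).2
  let f (d : D) : HeapClass (Crossing (r := r)) :=
    Quotient.mk _ (blockHeap (hpart d) (mem_heapOrdersWithMaxIn.1 (hord d)).1)
  have hf : Function.Injective f := by
    intro d d' hdd'
    have hle := IsHeapOrder.subset_of_iso_toHeap (Quotient.exact hdd')
    have hge := IsHeapOrder.subset_of_iso_toHeap (Quotient.exact hdd'.symm)
    exact Subtype.ext (Sigma.ext (hle.1.antisymm hge.1) (heq_of_eq (hle.2.antisymm hge.2)))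
  have hrange : blockPyramids r n = Set.range f := by
    ext q
    constructor
    · intro hq
      obtain ⟨W, ρ, hW, hρ, rfl⟩ := exists_mk_blockHeap_eq hq
      exact ⟨⟨⟨W, ρ⟩, mem_sigma.2 ⟨mem_uniformPartitions.2 hW, hρ⟩⟩, rfl⟩
    · rintro ⟨d, rfl⟩
      exact mk_blockHeap_mem_blockPyramids hr hn (hpart d) (hord d)
  rw [hrange]
  refine ⟨Set.finite_range f, ?_⟩
  rw [← Nat.card_coe_set_eq, Nat.card_range_of_injective hf, Nat.card_eq_finsetCard, card_sigma,
    pyramidCount]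

end BlockPyramids

theorem mainTheorem3 (r n : ℕ) (hr : 1 ≤ r) (hn : 1 ≤ n) :
    (blockPyramids r n).Finite ∧
      rNumber (fun k => DivPartition r k) n = ((blockPyramids r n).ncard : ℚ) := by
  obtain ⟨hfin, hcard⟩ := finite_blockPyramids_and_ncard hr hn
  have hrn : r * n ∈ Icc 1 (r * n) := right_mem_Icc.2 (Nat.mul_pos hr hn)
  have hrec := fun m hm =>
    sum_choose_mul_rNumber hr (factorial_mul_numMinimal_divPartition hr) (m := m) hm
  refine ⟨hfin, ?_⟩
  rw [hcard, pyramidCount_eq hr hrec hrn (Nat.card_Icc 1 (r * n))]
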